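/- Let $G$ be a finite directed multigraph (loops and parallel edges allowed) with a rotation system, i.e. a clockwise cyclic order of the edge ends around each vertex. Suppose that: (C1) every vertex of $G$ has exactly two incoming and exactly two outgoing edges; (C2) the rotation system describes a cellular embedding of $G$ in the torus (that is, $G$ is nonempty and connected and $|V|-|E|+|F|=0$, where $F$ is the set of faces, obtained by tracing facial walks), and every facial walk has length at least $3$; (C3) every directed circuit of $G$ (closed directed walk without repeated edges) is non-contractible in the torus. These conditions imply that at each vertex the two outgoing edges are rotationally consecutive; the edges met in clockwise order around a vertex are called its left outgoing, right outgoing, right incoming and left incoming edge, in this order. A walk passes a vertex each time it enters the vertex along an edge and leaves it along the next edge. Two passages of the same vertex (of two walks, or of one walk) are transverse if one enters along the left incoming edge and leaves along the right outgoing edge while the other enters along the right incoming edge and leaves along the left outgoing edge. The start and the end of a non-closed walk are not passages. Two walks have a transverse intersection if some passage of one and some passage of the other are transverse. Let $\mathcal P$ be a partition of the edges of $G$ into directed circuits no two of which (and none of which with itself) have a transverse intersection, and let $P\in\mathcal P$ be a directed cycle, i.e. a circuit that visits no vertex twice. Then there is a directed walk $W$ in $G$ with edges $e_1,\dots,e_k$,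 $k\ge 1$, such that - $W$ starts at a vertex $v$ of $P$, and $e_1\notin P$ is the left outgoing edge of $v$; - $W$ ends at a vertex $w$ of $P$, and $e_k\notin P$ is the right incoming edge of $w$; - $W$ has no transverse intersection with $P$ and shares no edge with $P$. Here $v=w$ is allowed, and $W$ is regarded as a non-closed walk even then. -/

import Mathlib

/-- A directed multigraph (loops and parallel edges allowed) with vertex type `V` and edge type `E`,
together with a rotation system.  Every edge `e` has two ends: `Sum.inl e`, its outgoing end, which is
incident to `tail e`, and `Sum.inr e`, its incoming end, which is incident to `head e`.
The permutation `rot` sends an edge end to the next one in clockwise order around its vertex;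
the ends incident to one vertex form one cycle of `rot`. -/
structure EmbeddedDigraph (V E : Type*) where
  tail : E → V
  head : E → V
  rot : Equiv.Perm (E ⊕ E)
  rot_vertex : ∀ d : E ⊕ E, Sum.elim tail head (rot d) = Sum.elim tail head d
  rot_cyclic : ∀ d d' : E ⊕ E,
    Sum.elim tail head d = Sum.elim tail head d' → rot.SameCycle d d'

namespace EmbeddedDigraph

variable {V E : Type*} (G : EmbeddedDigraph V E)

/-! ### Facial walks

An element `d : E ⊕ E` is also read as a traversal of an edge that starts at the end `d`:
`Sum.inl e` traverses `e` forwards and `Sum.inr e` traverses `e` backwards. -/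

/-- The vertex at which the traversal `d` starts, i.e. the vertex incident to the edge end `d`. -/
def src (d : E ⊕ E) : V := Sum.elim G.tail G.head d

/-- The vertex at which the traversal `d` stops. -/
def tgt (d : E ⊕ E) : V := G.src d.swap

/-- The successor of a traversal in the facial walk that contains it: arrive at the other end of the
edge and leave along the clockwise next edge end. -/
def faceNext : Equiv.Perm (E ⊕ E) := (Equiv.sumComm E E).trans G.rot

/-- The faces are the orbits of `faceNext`. -/
def Face : Type _ := Quotient (Equiv.Perm.SameCycle.setoid G.faceNext)

/-- The length of the facial walk through `d`. -/
noncomputable def faceLength (d : E ⊕ E) : ℕ := Function.minimalPeriod G.faceNext d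

/-- The facial walk that starts with `d`. -/
noncomputable def facialWalk (d : E ⊕ E) : List (E ⊕ E) :=
  (List.range (G.faceLength d)).map fun i => G.faceNext^[i] d

/-! ### Undirected walks and homotopy -/

/-- `l` is an (undirected) walk from `u` to `v`. -/
def IsWalk (u v : V) : List (E ⊕ E) → Prop
  | [] => u = v
  | d :: l => G.src d = u ∧ IsWalk (G.tgt d) v l

/-- The walk `q` from `u` to `v` arises from the walk `p` from `u` to `v` by deleting either a
traversal immediately followed by its reversal, or a complete facial walk. -/
def HomotopyStep (u v : V) (p q : List (E ⊕ E)) : Prop :=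
  G.IsWalk u v p ∧ G.IsWalk u v q ∧ ∃ l₁ b l₂ : List (E ⊕ E),
    ((∃ d, b = [d, d.swap]) ∨ (∃ d, b = G.facialWalk d)) ∧ p = l₁ ++ b ++ l₂ ∧ q = l₁ ++ l₂

/-- Homotopy with fixed endpoints of walks from `u` to `v` in the closed surface that is obtained by
gluing a disk along every facial walk. -/
def Homotopic (u v : V) : List (E ⊕ E) → List (E ⊕ E) → Prop :=
  Relation.EqvGen (G.HomotopyStep u v)

/-! ### Directed walks, circuits and cycles, as lists of edges -/

/-- The pairs of consecutive edges of a walk. -/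
def walkPassages (l : List E) : List (E × E) := l.zip l.tail

/-- The pairs of cyclically consecutive edges of a closed walk. -/
def circuitPassages (l : List E) : List (E × E) := l.zip (l.rotate 1)

/-- A directed walk with at least one edge. -/
def IsDirectedWalk (l : List E) : Prop :=
  l ≠ [] ∧ ∀ p ∈ walkPassages l, G.head p.1 = G.tail p.2

/-- A directed circuit: a closed directed walk without repeated edges. -/
def IsDirectedCircuit (l : List E) : Prop :=
  l ≠ [] ∧ l.Nodup ∧ ∀ p ∈ circuitPassages l, G.head p.1 = G.tail p.2

/-- A directed cycle: a directed circuit without repeated vertices. -/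
def IsDirectedCycle (l : List E) : Prop :=
  G.IsDirectedCircuit l ∧ (l.map G.tail).Nodup

/-- The vertices of a directed circuit. -/
def circuitVertices (l : List E) : Set V := {v | ∃ e ∈ l, G.tail e = v}

/-- A directed closed walk is contractible if it is homotopic to a constant walk. -/
def IsContractible (l : List E) : Prop :=
  ∃ x : V, G.Homotopic x x (l.map Sum.inl) []

/-! ### The conditions on the embedded digraph -/

/-- Every vertex has exactly two outgoing and exactly two incoming edges. -/
def IsTwoTwoRegular : Prop :=
  ∀ v : V, Nat.card {e : E // G.tail e = v} = 2 ∧ Nat.card {e : E // G.head e = v} = 2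

/-- The underlying undirected graph is connected (and not empty). -/
def IsConnected : Prop :=
  Nonempty V ∧ ∀ u v : V, Relation.EqvGen (fun a b => ∃ e, G.tail e = a ∧ G.head e = b) u v

/-- The rotation system describes a cellular embedding in the torus. -/
def IsToroidal : Prop :=
  G.IsConnected ∧ (Nat.card V : ℤ) - Nat.card E + Nat.card G.Face = 0

/-- Every facial walk has at least three edges. -/
def FacesAtLeastThree : Prop := ∀ d : E ⊕ E, 3 ≤ G.faceLength d

/-- All directed circuits are non-contractible. -/
def CircuitsNonContractible : Prop :=
  ∀ C : List E, G.IsDirectedCircuit C → ¬ G.IsContractible C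

/-! ### Left and right

If the two outgoing edge ends at a vertex are rotationally consecutive, then the clockwise order
around the vertex is: left outgoing, right outgoing, right incoming, left incoming. -/

/-- `e` is the left outgoing edge at its tail. -/
def IsLeftOut (e : E) : Prop := ∃ f, G.rot (Sum.inl e) = Sum.inl f

/-- `e` is the right outgoing edge at its tail. -/
def IsRightOut (e : E) : Prop := ∃ f, G.rot (Sum.inl f) = Sum.inl e

/-- `e` is the right incoming edge at its head. -/
def IsRightIn (e : E) : Prop := ∃ f, G.rot (Sum.inr e) = Sum.inr f

/-- `e` is the left incoming edge at its head. -/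
def IsLeftIn (e : E) : Prop := ∃ f, G.rot (Sum.inr f) = Sum.inr e

/-! ### Transverse intersections and osculating circuits -/

/-- The passage `p` enters a vertex from the left and exits to the right, while the passage `q`
enters the same vertex from the right and exits to the left. -/
def CrossesLeftToRight (p q : E × E) : Prop :=
  G.head p.1 = G.head q.1 ∧
    G.IsLeftIn p.1 ∧ G.IsRightOut p.2 ∧ G.IsRightIn q.1 ∧ G.IsLeftOut q.2

/-- Two families of passages have a transverse intersection. -/
def HasTransverseIntersection (A B : List (E × E)) : Prop :=
  ∃ p ∈ A, ∃ q ∈ B, G.CrossesLeftToRight p q ∨ G.CrossesLeftToRight q p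

/-- `Part` is a partition of the edges into directed circuits none of which has a transverse
intersection with another one or with itself.  (Every circuit in `Part` is written as a list that
starts with an arbitrary one of its edges.) -/
def IsOsculatingPartition (Part : Set (List E)) : Prop :=
  (∀ C ∈ Part, G.IsDirectedCircuit C) ∧
  (∀ e : E, ∃! C, C ∈ Part ∧ e ∈ C) ∧
  ∀ C ∈ Part, ∀ D ∈ Part,
    ¬ G.HasTransverseIntersection (circuitPassages C) (circuitPassages D)

end EmbeddedDigraph

/-!
Why the walk exists.  A facial walk that runs along all its edges, or against all of them, would give
a contractible directed circuit.  So every face has a source corner, i.e. a corner between two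
outgoing edge ends, and a vertex has at most one such corner.  By Euler's formula for the torus there
are as many faces as vertices; hence every vertex and every face has exactly one source corner
(`EmbeddedDigraph.exists_compass`), and the four edges at a vertex can be named by their position.

As `P` belongs to an osculating partition and is a cycle, it never changes sides at a vertex: it uses
the two right edges or the two left edges there (`Compass.cases_of_mem_circuitVertices`).  Let `X` be
the set of edges that are reached by directed walks which leave `P` to the left and do not meet `P`
again before their end.  If none of these walks arrives at `P` from the right, then comparing
in-degrees and out-degrees shows that `X` is also closed under taking predecessors, so that `P`
separates the edges of `X` from the others (`Compass.isCut_of_forall_not_isRightIn`).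

That is impossible for reasons of parity (`Compass.IsCut.false`).  The faces on the `X` side of `P`,
together with one new face glued in along `P`, form a closed oriented surface, possibly disconnected.
Every face on the `X` side has exactly one source corner, and this determines the number of faces
and gives an odd Euler characteristic.  But for an oriented surface the Euler characteristic is even:
the rotation is the product of the permutation that traces the faces and the involution that reverses
the edges, and the sign of a permutation is determined by its number of orbits.
-/

/-! ### Signs of permutations -/

/-- The sign of a permutation is determined by its number of orbits (fixed points included); here the
orbits are counted by a transversal `S`. -/
theorem Equiv.Perm.sign_eq_neg_one_pow_of_transversal {α : Type*} [Fintype α] [DecidableEq α]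
    (f : Equiv.Perm α) (S : Finset α) (hS : ∀ a, ∃ s ∈ S, f.SameCycle a s)
    (hS' : ∀ s ∈ S, ∀ t ∈ S, f.SameCycle s t → s = t) :
    Equiv.Perm.sign f = (-1) ^ (Fintype.card α + S.card) := by
  have hfix : f.supportᶜ = S \ f.support := by
    ext a
    simp only [Finset.mem_compl, Finset.mem_sdiff]
    refine ⟨fun ha => ⟨?_, ha⟩, fun ha => ha.2⟩
    obtain ⟨s, hs, has⟩ := hS a
    have : a = s := has.eq_of_left (by simpa [Function.IsFixedPt] using ha)
    rwa [this]
  have hcyc : (S ∩ f.support).card = f.cycleFactorsFinset.card := by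
    refine Finset.card_bij (fun a _ => f.cycleOf a) ?_ ?_ ?_
    · intro a ha
      exact Equiv.Perm.cycleOf_mem_cycleFactorsFinset_iff.2 (Finset.mem_inter.1 ha).2
    · intro a ha b hb hab
      rw [Finset.mem_inter] at ha hb
      exact hS' a ha.1 b hb.1
        ((Equiv.Perm.sameCycle_iff_cycleOf_eq_of_mem_support ha.2 hb.2).2 hab)
    · intro c hc
      obtain ⟨a, ha⟩ := (Equiv.Perm.mem_cycleFactorsFinset_iff.1 hc).1.nonempty_support
      have hac := Equiv.Perm.cycle_is_cycleOf ha hc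
      have haf : a ∈ f.support := Equiv.Perm.mem_cycleFactorsFinset_support_le hc ha
      obtain ⟨s, hs, has⟩ := hS a
      exact ⟨s, Finset.mem_inter.2 ⟨hs, has.mem_support_iff.1 haf⟩, by rw [hac, has.cycleOf_eq]⟩
  have h1 : f.support.card + f.supportᶜ.card = Fintype.card α := Finset.card_add_card_compl _
  have h2 : (S \ f.support).card + (S ∩ f.support).card = S.card :=
    Finset.card_sdiff_add_card_inter _ _
  have h3 : f.cycleType.card = f.cycleFactorsFinset.card := by
    rw [Equiv.Perm.cycleType_def, Multiset.card_map]; rfl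
  rw [Equiv.Perm.sign_of_cycleType, Equiv.Perm.sum_cycleType, h3, ← hcyc, ← h1, ← h2, hfix]
  rw [show f.support.card + (S \ f.support).card + ((S \ f.support).card + (S ∩ f.support).card)
    = (f.support.card + (S ∩ f.support).card) + 2 * (S \ f.support).card by ring, pow_add _ (_ + _),
    pow_mul]
  simp

theorem List.sign_formPerm {α : Type*} [Fintype α] [DecidableEq α] :
    ∀ l : List α, l ≠ [] → l.Nodup → Equiv.Perm.sign l.formPerm = (-1) ^ (l.length + 1)
  | [], h, _ => absurd rfl h
  | [x], _, _ => by simp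
  | x :: y :: l, _, hnd => by
    have hxy : x ≠ y := fun h => by simp [h] at hnd
    rw [List.formPerm_cons_cons, Equiv.Perm.sign_mul, Equiv.Perm.sign_swap hxy,
      List.sign_formPerm (y :: l) (by simp) hnd.of_cons]
    simp [pow_succ]

theorem Equiv.Perm.SameCycle.mem_of_mapsTo {α : Type*} [Finite α] {f : Equiv.Perm α} {x y : α}
    (h : f.SameCycle x y) {K : Set α} (hK : Set.MapsTo f K K) (hx : x ∈ K) : y ∈ K := by
  obtain ⟨i, -, rfl⟩ := h.exists_pow_eq'
  rw [Equiv.Perm.coe_pow]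
  exact hK.iterate i hx

namespace EmbeddedDigraph

variable {V E : Type*} (G : EmbeddedDigraph V E)

/-! ### Contractible facial walks -/

@[simp] theorem src_inl (e : E) : G.src (Sum.inl e) = G.tail e := rfl
@[simp] theorem src_inr (e : E) : G.src (Sum.inr e) = G.head e := rfl

theorem src_rot (d : E ⊕ E) : G.src (G.rot d) = G.src d := G.rot_vertex d

@[simp] theorem faceNext_inl (e : E) : G.faceNext (Sum.inl e) = G.rot (Sum.inr e) := rfl
@[simp] theorem faceNext_inr (e : E) : G.faceNext (Sum.inr e) = G.rot (Sum.inl e) := rfl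

theorem src_faceNext (d : E ⊕ E) : G.src (G.faceNext d) = G.tgt d := G.src_rot _

theorem tgt_swap (d : E ⊕ E) : G.tgt d.swap = G.src d := by simp [tgt]

variable {G} in
theorem IsWalk.append {u v w : V} {p q : List (E ⊕ E)} (hp : G.IsWalk u v p)
    (hq : G.IsWalk v w q) : G.IsWalk u w (p ++ q) := by
  induction p generalizing u with
  | nil => obtain rfl : u = v := hp; exact hq
  | cons d p ih => exact ⟨hp.1, ih hp.2⟩

/-- The reversal of a walk. -/
def reverseWalk (p : List (E ⊕ E)) : List (E ⊕ E) := (p.map Sum.swap).reverse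

variable {G} in
theorem IsWalk.reverse {u v : V} {p : List (E ⊕ E)} (hp : G.IsWalk u v p) :
    G.IsWalk v u (reverseWalk p) := by
  induction p generalizing u with
  | nil => exact Eq.symm hp
  | cons d p ih =>
    rw [reverseWalk, List.map_cons, List.reverse_cons]
    exact (ih hp.2).append ⟨rfl, by rw [tgt_swap]; exact hp.1⟩

variable {G} in
theorem IsWalk.homotopic_reverseWalk_append {u v : V} {p : List (E ⊕ E)} (hp : G.IsWalk u v p) :
    G.Homotopic v v (reverseWalk p ++ p) [] := by
  induction p generalizing u with
  | nil => exact Relation.EqvGen.refl _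
  | cons d p ih =>
    refine Relation.EqvGen.trans _ _ _ (Relation.EqvGen.rel _ _
      ⟨hp.reverse.append hp, hp.2.reverse.append hp.2, ?_⟩) (ih hp.2)
    exact ⟨reverseWalk p, [d.swap, d.swap.swap], p, Or.inl ⟨_, rfl⟩,
      by simp [reverseWalk], rfl⟩

theorem isWalk_map_range (d : E ⊕ E) (n : ℕ) :
    G.IsWalk (G.src d) (G.src (G.faceNext^[n] d))
      ((List.range n).map fun i => G.faceNext^[i] d) := by
  induction n with
  | zero => exact rfl
  | succ n ih =>
    rw [List.range_succ, List.map_append]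
    exact ih.append ⟨rfl, by rw [Function.iterate_succ_apply', src_faceNext]; exact rfl⟩

theorem isWalk_facialWalk (d : E ⊕ E) : G.IsWalk (G.src d) (G.src d) (G.facialWalk d) := by
  have h := G.isWalk_map_range d (G.faceLength d)
  rwa [faceLength, Function.iterate_minimalPeriod] at h

theorem homotopic_facialWalk (d : E ⊕ E) :
    G.Homotopic (G.src d) (G.src d) (G.facialWalk d) [] :=
  Relation.EqvGen.rel _ _ ⟨G.isWalk_facialWalk d, rfl, [], G.facialWalk d, [],
    Or.inr ⟨d, rfl⟩, by simp, rfl⟩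

theorem homotopic_reverseWalk_facialWalk (d : E ⊕ E) :
    G.Homotopic (G.src d) (G.src d) (reverseWalk (G.facialWalk d)) [] := by
  have h := G.isWalk_facialWalk d
  refine Relation.EqvGen.trans _ _ _ (Relation.EqvGen.symm _ _ (Relation.EqvGen.rel _ _
    ⟨h.reverse.append h, h.reverse, reverseWalk (G.facialWalk d), G.facialWalk d, [],
      Or.inr ⟨d, rfl⟩, by simp, by simp⟩)) h.homotopic_reverseWalk_append

theorem mem_circuitPassages_iff {l : List E} {p : E × E} :
    p ∈ circuitPassages l ↔ ∃ (i : ℕ) (hi : i < l.length),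
      p = (l[i], l[(i + 1) % l.length]'(Nat.mod_lt _ (by omega))) := by
  rw [circuitPassages, List.mem_iff_getElem]
  constructor
  · rintro ⟨i, hi, rfl⟩
    have hi' : i < l.length := by simpa using hi
    exact ⟨i, hi', by simp [List.getElem_rotate]⟩
  · rintro ⟨i, hi, rfl⟩
    exact ⟨i, by simpa using hi, by simp [List.getElem_rotate]⟩

theorem isDirectedCircuit_map_range {n : ℕ} (hn : 0 < n) (g : ℕ → E)
    (hinj : Set.InjOn g (Set.Iio n)) (hg : ∀ i < n, G.head (g i) = G.tail (g ((i + 1) % n))) :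
    G.IsDirectedCircuit ((List.range n).map g) := by
  refine ⟨by simp; omega, ?_, ?_⟩
  · refine List.Nodup.map_on ?_ List.nodup_range
    intro i hi j hj h
    exact hinj (by simpa using hi) (by simpa using hj) h
  · intro p hp
    obtain ⟨i, hi, rfl⟩ := mem_circuitPassages_iff.1 hp
    simpa using hg i (by simpa using hi)

variable {G}

theorem faceLength_pos [Finite E] (d : E ⊕ E) : 0 < G.faceLength d :=
  Function.minimalPeriod_pos_of_mem_periodicPts (G.faceNext.injective.mem_periodicPts d)

/-- A facial walk that runs along all its edges would be a contractible directed circuit. -/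
theorem exists_faceNext_iterate_eq_inr [Finite E] (hC3 : G.CircuitsNonContractible) (d : E ⊕ E) :
    ∃ k e, G.faceNext^[k] d = Sum.inr e := by
  by_contra! hcon
  have hl : ∀ k, ∃ e, G.faceNext^[k] d = Sum.inl e := fun k => by
    rcases h : G.faceNext^[k] d with e | e
    · exact ⟨e, rfl⟩
    · exact absurd h (hcon k e)
  choose g hg using hl
  have hn := faceLength_pos (G := G) d
  refine hC3 _ (G.isDirectedCircuit_map_range hn g ?_ ?_) ⟨G.src d, ?_⟩
  · intro i hi j hj h
    exact Function.iterate_injOn_Iio_minimalPeriod (f := G.faceNext) (x := d) hi hj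
      (by simp only [hg, h])
  · intro i hi
    have h1 : Sum.inl (g ((i + 1) % G.faceLength d)) = G.faceNext (Sum.inl (g i)) := by
      rw [← hg, ← hg, ← Function.iterate_succ_apply' (f := G.faceNext), faceLength,
        Function.iterate_mod_minimalPeriod_eq]
    rw [← src_inl, h1, src_faceNext]
    rfl
  · have h2 : ((List.range (G.faceLength d)).map g).map Sum.inl = G.facialWalk d := by
      simp [facialWalk, hg, Function.comp_def]
    rw [h2]
    exact G.homotopic_facialWalk d

/-- A facial walk that runs against all its edges would be the reversal of a contractible directed
circuit. -/
theorem exists_faceNext_iterate_eq_inl [Finite E] (hC3 : G.CircuitsNonContractible) (d : E ⊕ E) :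
    ∃ k e, G.faceNext^[k] d = Sum.inl e := by
  by_contra! hcon
  have hr : ∀ k, ∃ e, G.faceNext^[k] d = Sum.inr e := fun k => by
    rcases h : G.faceNext^[k] d with e | e
    · exact absurd h (hcon k e)
    · exact ⟨e, rfl⟩
  choose g hg using hr
  have hn := faceLength_pos (G := G) d
  set n := G.faceLength d with hn_def
  have hstep : ∀ i, G.tail (g i) = G.head (g ((i + 1) % n)) := fun i => by
    have h1 : Sum.inr (g ((i + 1) % n)) = G.faceNext (Sum.inr (g i)) := by
      rw [← hg, ← hg, ← Function.iterate_succ_apply' (f := G.faceNext), hn_def, faceLength,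
        Function.iterate_mod_minimalPeriod_eq]
    rw [← src_inr, h1, src_faceNext]
    rfl
  refine hC3 _ (G.isDirectedCircuit_map_range hn (fun i => g (n - 1 - i)) ?_ ?_) ⟨G.src d, ?_⟩
  · intro i hi j hj h
    have hi' : i < n := hi
    have hj' : j < n := hj
    have := Function.iterate_injOn_Iio_minimalPeriod (f := G.faceNext) (x := d)
      (show n - 1 - i < n by omega) (show n - 1 - j < n by omega) (by
        simp only [hg]; exact congrArg Sum.inr h)
    omega
  · intro i hi
    by_cases h : i + 1 < n
    · rw [Nat.mod_eq_of_lt h, hstep, Nat.mod_eq_of_lt (by omega)]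
      congr 2; omega
    · obtain rfl : i = n - 1 := by omega
      rw [Nat.sub_add_cancel hn, Nat.mod_self, hstep]
      congr 2
      rw [Nat.sub_zero, Nat.sub_add_cancel hn, Nat.mod_self]; omega
  · have h2 : ((List.range n).map (fun i => g (n - 1 - i))).map Sum.inl =
        reverseWalk (G.facialWalk d) := by
      apply List.ext_getElem
      · simp [facialWalk, reverseWalk, hn_def]
      · intro i h1 h2
        simp [facialWalk, reverseWalk, hg, ← hn_def]
    rw [h2]
    exact G.homotopic_reverseWalk_facialWalk d

/-- The facial walk changes somewhere from running against an edge to running along an edge. -/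
theorem exists_source_corner [Finite E] (hC3 : G.CircuitsNonContractible) (d : E ⊕ E) :
    ∃ e, G.IsLeftOut e ∧ G.faceNext.SameCycle d (Sum.inr e) := by
  obtain ⟨k, e, hk⟩ := exists_faceNext_iterate_eq_inr hC3 d
  by_contra! hcon
  have hall : ∀ j, ∃ e', G.faceNext^[j] (Sum.inr e) = Sum.inr e' := fun j => by
    induction j with
    | zero => exact ⟨e, rfl⟩
    | succ j ih =>
      obtain ⟨e', he'⟩ := ih
      rw [Function.iterate_succ_apply', he']
      rcases h : G.faceNext (Sum.inr e') with f | f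
      · refine absurd ?_ (hcon e' ⟨f, h⟩)
        refine ⟨(j + k : ℕ), ?_⟩
        rw [zpow_natCast, Equiv.Perm.coe_pow, Function.iterate_add_apply, hk, he']
      · exact ⟨f, rfl⟩
  obtain ⟨j, e', hj⟩ := exists_faceNext_iterate_eq_inl hC3 (Sum.inr e)
  obtain ⟨e'', h⟩ := hall j
  simp [hj] at h

/-! ### The four edge ends at a vertex -/

theorem IsTwoTwoRegular.exists_out (h : G.IsTwoTwoRegular) (v : V) :
    ∃ a b, a ≠ b ∧ ∀ e, G.tail e = v ↔ e = a ∨ e = b := by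
  obtain ⟨x, y, hxy, hu⟩ := Nat.card_eq_two_iff.1 (h v).1
  refine ⟨x, y, fun h => hxy (Subtype.ext h), fun e => ⟨fun he => ?_, ?_⟩⟩
  · have : (⟨e, he⟩ : {e : E // G.tail e = v}) ∈ ({x, y} : Set _) := hu ▸ Set.mem_univ _
    rcases this with h | h
    · exact Or.inl (congrArg Subtype.val h)
    · exact Or.inr (congrArg Subtype.val h)
  · rintro (rfl | rfl)
    exacts [x.2, y.2]

theorem IsTwoTwoRegular.exists_in (h : G.IsTwoTwoRegular) (v : V) :
    ∃ a b, a ≠ b ∧ ∀ e, G.head e = v ↔ e = a ∨ e = b := by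
  obtain ⟨x, y, hxy, hu⟩ := Nat.card_eq_two_iff.1 (h v).2
  refine ⟨x, y, fun h => hxy (Subtype.ext h), fun e => ⟨fun he => ?_, ?_⟩⟩
  · have : (⟨e, he⟩ : {e : E // G.head e = v}) ∈ ({x, y} : Set _) := hu ▸ Set.mem_univ _
    rcases this with h | h
    · exact Or.inl (congrArg Subtype.val h)
    · exact Or.inr (congrArg Subtype.val h)
  · rintro (rfl | rfl)
    exacts [x.2, y.2]

theorem IsTwoTwoRegular.card_edges [Finite V] [Finite E] (h : G.IsTwoTwoRegular) :
    Nat.card E = 2 * Nat.card V := by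
  have := Fintype.ofFinite V
  rw [Nat.card_congr (Equiv.sigmaFiberEquiv G.tail).symm, Nat.card_sigma]
  simp [fun v => (h v).1, mul_comm]

/-- Edge ends at one vertex cannot be separated by a set that is invariant under the rotation. -/
theorem mem_of_mapsTo_rot [Finite E] {d d' : E ⊕ E} (h : G.src d = G.src d') {K : Set (E ⊕ E)}
    (hK : Set.MapsTo G.rot K K) (hd : d ∈ K) : d' ∈ K :=
  (G.rot_cyclic d d' h).mem_of_mapsTo hK hd

/-- A vertex has at most one left outgoing edge. -/
theorem IsTwoTwoRegular.eq_of_isLeftOut [Finite E] (h : G.IsTwoTwoRegular) {e e' : E}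
    (he : G.IsLeftOut e) (he' : G.IsLeftOut e') (ht : G.tail e = G.tail e') : e = e' := by
  by_contra hne
  obtain ⟨f, hf⟩ := he
  obtain ⟨f', hf'⟩ := he'
  obtain ⟨a, b, hab, hout⟩ := h.exists_out (G.tail e)
  obtain ⟨c, _, _, hin⟩ := h.exists_in (G.tail e)
  have h1 := (hout e).1 rfl
  have h2 := (hout e').1 ht.symm
  have h3 := (hout f).1 (by rw [← src_inl, ← hf, src_rot, src_inl])
  have h4 := (hout f').1 (by rw [← src_inl, ← hf', src_rot, src_inl, ht])
  have hc : (Sum.inr c : E ⊕ E) ∈ ({Sum.inl a, Sum.inl b} : Set (E ⊕ E)) := by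
    refine mem_of_mapsTo_rot (G := G) (d := Sum.inl e) ?_ ?_ ?_
    · rw [src_inl, src_inr, (hin c).2 (Or.inl rfl)]
    · have : ∀ x, x = a ∨ x = b → ∃ y, (y = a ∨ y = b) ∧ G.rot (Sum.inl x) = Sum.inl y := by
        intro x hx
        have : x = e ∨ x = e' := by
          rcases hx with rfl | rfl <;> rcases h1 with rfl | rfl <;> rcases h2 with rfl | rfl <;>
            simp_all
        rcases this with rfl | rfl
        exacts [⟨f, h3, hf⟩, ⟨f', h4, hf'⟩]
      rintro x (rfl | rfl)
      · obtain ⟨y, rfl | rfl, hr⟩ := this a (Or.inl rfl) <;> simp [hr]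
      · obtain ⟨y, rfl | rfl, hr⟩ := this b (Or.inr rfl) <;> simp [hr]
    · rcases h1 with h | h <;> simp [← h]
  simp at hc

/-- If a vertex has a left outgoing edge, then the two outgoing and the two incoming edge ends are
rotationally consecutive. -/
theorem IsTwoTwoRegular.rot_of_isLeftOut [Finite E] (h : G.IsTwoTwoRegular) {a : E}
    (ha : G.IsLeftOut a) : ∃ b c d : E, a ≠ b ∧ c ≠ d ∧
      (∀ e, G.tail e = G.tail a ↔ e = a ∨ e = b) ∧ (∀ e, G.head e = G.tail a ↔ e = c ∨ e = d) ∧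
      G.rot (Sum.inl a) = Sum.inl b ∧ G.rot (Sum.inl b) = Sum.inr c ∧
      G.rot (Sum.inr c) = Sum.inr d ∧ G.rot (Sum.inr d) = Sum.inl a := by
  obtain ⟨b, hb⟩ := ha
  obtain ⟨a', b', hab', hout'⟩ := h.exists_out (G.tail a)
  obtain ⟨c', d', hcd', hin'⟩ := h.exists_in (G.tail a)
  have hne : a ≠ b := by
    rintro rfl
    have : (Sum.inr c' : E ⊕ E) ∈ ({Sum.inl a} : Set (E ⊕ E)) :=
      mem_of_mapsTo_rot (G := G) (by rw [src_inl, src_inr, (hin' c').2 (Or.inl rfl)])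
        (by rintro x rfl; exact hb) rfl
    simp at this
  have htb : G.tail b = G.tail a := by rw [← src_inl, ← hb, src_rot, src_inl]
  have hout : ∀ e, G.tail e = G.tail a ↔ e = a ∨ e = b := by
    have h1 := (hout' a).1 rfl
    have h2 := (hout' b).1 htb
    intro e
    rw [hout']
    rcases h1 with rfl | rfl <;> rcases h2 with rfl | rfl <;> simp_all [or_comm]
  obtain ⟨c, hc⟩ : ∃ c, G.rot (Sum.inl b) = Sum.inr c := by
    rcases hr : G.rot (Sum.inl b) with x | c
    · exact absurd (h.eq_of_isLeftOut ⟨b, hb⟩ ⟨x, hr⟩ htb.symm) hne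
    · exact ⟨c, rfl⟩
  have hhc : G.head c = G.tail a := by rw [← src_inr, ← hc, src_rot, src_inl, htb]
  obtain ⟨d, hcd, hin⟩ : ∃ d, c ≠ d ∧ ∀ e, G.head e = G.tail a ↔ e = c ∨ e = d := by
    rcases (hin' c).1 hhc with rfl | rfl
    · exact ⟨d', hcd', hin'⟩
    · exact ⟨c', hcd'.symm, fun e => by rw [hin', or_comm]⟩
  have hhd : G.head d = G.tail a := (hin d).2 (Or.inr rfl)
  have hrange : ∀ x, G.src x = G.tail a →
      x = Sum.inl a ∨ x = Sum.inl b ∨ x = Sum.inr c ∨ x = Sum.inr d := by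
    rintro (x | x) hx
    · rcases (hout x).1 hx with rfl | rfl <;> simp
    · rcases (hin x).1 hx with rfl | rfl <;> simp
  have hrc : G.rot (Sum.inr c) = Sum.inr d := by
    rcases hrange (G.rot (Sum.inr c)) (by rw [src_rot, src_inr, hhc]) with h1 | h1 | h1 | h1
    · have : (Sum.inr d : E ⊕ E) ∈ ({Sum.inl a, Sum.inl b, Sum.inr c} : Set (E ⊕ E)) :=
        mem_of_mapsTo_rot (G := G) (d := Sum.inl a) (by rw [src_inl, src_inr, hhd])
          (by rintro x (rfl | rfl | rfl) <;> simp [*]) (by simp)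
      simp [hcd.symm] at this
    · exact absurd (G.rot.injective (h1.trans hb.symm)) (by simp)
    · exact absurd (G.rot.injective (h1.trans hc.symm)) (by simp)
    · exact h1
  refine ⟨b, c, d, hne, hcd, hout, hin, hb, hc, hrc, ?_⟩
  rcases hrange (G.rot (Sum.inr d)) (by rw [src_rot, src_inr, hhd]) with h1 | h1 | h1 | h1
  · exact h1
  · exact absurd (G.rot.injective (h1.trans hb.symm)) (by simp)
  · exact absurd (G.rot.injective (h1.trans hc.symm)) (by simp)
  · exact absurd (G.rot.injective (h1.trans hrc.symm)) (by simpa using hcd.symm)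

variable (G) in
/-- The four edges at every vertex, named after their position: left outgoing, right outgoing,
right incoming and left incoming, in clockwise order.  The last two fields say that every face has
exactly one source corner, i.e. one corner between two outgoing edge ends; the facial walk through
the source corner at `v` reaches it along `Sum.inr (lo v)`. -/
structure Compass where
  lo : V → E
  ro : V → E
  ri : V → E
  li : V → E
  lo_ne_ro : ∀ v, lo v ≠ ro v
  ri_ne_li : ∀ v, ri v ≠ li v
  tail_eq_iff : ∀ v e, G.tail e = v ↔ e = lo v ∨ e = ro v
  head_eq_iff : ∀ v e, G.head e = v ↔ e = ri v ∨ e = li v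
  rot_lo : ∀ v, G.rot (Sum.inl (lo v)) = Sum.inl (ro v)
  rot_ro : ∀ v, G.rot (Sum.inl (ro v)) = Sum.inr (ri v)
  rot_ri : ∀ v, G.rot (Sum.inr (ri v)) = Sum.inr (li v)
  rot_li : ∀ v, G.rot (Sum.inr (li v)) = Sum.inl (lo v)
  exists_sameCycle : ∀ d, ∃ v, G.faceNext.SameCycle d (Sum.inr (lo v))
  eq_of_sameCycle : ∀ v w, G.faceNext.SameCycle (Sum.inr (lo v)) (Sum.inr (lo w)) → v = w

/-- Every face has at least one source corner and every vertex at most one.  On the torus there are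
as many faces as vertices, so both numbers are always one. -/
theorem exists_compass [Finite V] [Finite E] (hC1 : G.IsTwoTwoRegular) (hC2 : G.IsToroidal)
    (hC3 : G.CircuitsNonContractible) : Nonempty G.Compass := by
  have hfinite : Finite G.Face := Quotient.finite _
  have hface : Nat.card G.Face = Nat.card V := by
    have h1 := hC2.2
    have h2 := hC1.card_edges
    omega
  let toFace : {e // G.IsLeftOut e} → G.Face := fun e => Quotient.mk _ (Sum.inr e.1)
  let toVertex : {e // G.IsLeftOut e} → V := fun e => G.tail e.1
  have hsurj : Function.Surjective toFace := by
    intro F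
    induction F using Quotient.inductionOn with
    | h d =>
      obtain ⟨e, he, hde⟩ := exists_source_corner hC3 d
      exact ⟨⟨e, he⟩, Quotient.sound (Equiv.Perm.SameCycle.symm hde)⟩
  have hinj : Function.Injective toVertex := fun e e' h =>
    Subtype.ext (hC1.eq_of_isLeftOut e.2 e'.2 h)
  have hle : Nat.card {e // G.IsLeftOut e} ≤ Nat.card V := Nat.card_le_card_of_injective _ hinj
  have hle' : Nat.card V ≤ Nat.card {e // G.IsLeftOut e} :=
    hface ▸ Nat.card_le_card_of_surjective _ hsurj
  have hbV := hinj.bijective_of_nat_card_le hle'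
  have hbF := hsurj.bijective_of_nat_card_le (hface ▸ hle)
  choose lo hlo using hbV.2
  have hlo' : ∀ v, G.tail (lo v).1 = v := hlo
  choose ro ri li h1 h2 h3 h4 h5 h6 h7 h8 using fun v => hC1.rot_of_isLeftOut (lo v).2
  refine ⟨⟨fun v => (lo v).1, ro, ri, li, h1, h2, fun v e => ?_, fun v e => ?_, h5, h6, h7, h8,
    fun d => ?_, fun v w h => ?_⟩⟩
  · rw [← h3, hlo']
  · rw [← h4, hlo']
  · obtain ⟨e, he, hde⟩ := exists_source_corner hC3 d
    refine ⟨G.tail e, ?_⟩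
    have : lo (G.tail e) = ⟨e, he⟩ := hinj (hlo _)
    rw [this]
    exact hde
  · have : lo v = lo w := hbF.1 (Quotient.sound h)
    rw [← hlo' v, this, hlo']

namespace Compass

variable (c : G.Compass)

@[simp] theorem tail_lo (v : V) : G.tail (c.lo v) = v := (c.tail_eq_iff v _).2 (Or.inl rfl)
@[simp] theorem tail_ro (v : V) : G.tail (c.ro v) = v := (c.tail_eq_iff v _).2 (Or.inr rfl)
@[simp] theorem head_ri (v : V) : G.head (c.ri v) = v := (c.head_eq_iff v _).2 (Or.inl rfl)
@[simp] theorem head_li (v : V) : G.head (c.li v) = v := (c.head_eq_iff v _).2 (Or.inr rfl)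

theorem eq_lo_or_eq_ro (e : E) : e = c.lo (G.tail e) ∨ e = c.ro (G.tail e) :=
  (c.tail_eq_iff _ e).1 rfl

theorem eq_ri_or_eq_li (e : E) : e = c.ri (G.head e) ∨ e = c.li (G.head e) :=
  (c.head_eq_iff _ e).1 rfl

theorem isLeftOut_lo (v : V) : G.IsLeftOut (c.lo v) := ⟨_, c.rot_lo v⟩
theorem isRightOut_ro (v : V) : G.IsRightOut (c.ro v) := ⟨_, c.rot_lo v⟩
theorem isRightIn_ri (v : V) : G.IsRightIn (c.ri v) := ⟨_, c.rot_ri v⟩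
theorem isLeftIn_li (v : V) : G.IsLeftIn (c.li v) := ⟨_, c.rot_ri v⟩

theorem sum_lo_add_ro [Fintype V] [Fintype E] {M : Type*} [AddCommMonoid M] (x : E → M) :
    ∑ v, (x (c.lo v) + x (c.ro v)) = ∑ e, x e := by
  classical
  rw [← Finset.sum_fiberwise Finset.univ G.tail x]
  refine Finset.sum_congr rfl fun v _ => ?_
  have : Finset.univ.filter (fun e => G.tail e = v) = {c.lo v, c.ro v} := by
    ext e; simp [c.tail_eq_iff]
  rw [this, Finset.sum_pair (c.lo_ne_ro v)]

theorem sum_ri_add_li [Fintype V] [Fintype E] {M : Type*} [AddCommMonoid M] (x : E → M) :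
    ∑ v, (x (c.ri v) + x (c.li v)) = ∑ e, x e := by
  classical
  rw [← Finset.sum_fiberwise Finset.univ G.head x]
  refine Finset.sum_congr rfl fun v _ => ?_
  have : Finset.univ.filter (fun e => G.head e = v) = {c.ri v, c.li v} := by
    ext e; simp [c.head_eq_iff]
  rw [this, Finset.sum_pair (c.ri_ne_li v)]

end Compass

/-! ### A directed cycle does not separate -/

theorem sign_sumComm (α : Type*) [Fintype α] [DecidableEq α] :
    Equiv.Perm.sign (Equiv.sumComm α α : Equiv.Perm (α ⊕ α)) = (-1) ^ Fintype.card α := by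
  rw [Equiv.Perm.sign_eq_neg_one_pow_of_transversal _ (Finset.univ.disjSum ∅), Finset.card_disjSum,
    Fintype.card_sum]
  · simp [pow_add]
  · rintro (a | a)
    · exact ⟨Sum.inl a, by simp, .refl _ _⟩
    · exact ⟨Sum.inl a, by simp, Equiv.Perm.sameCycle_apply_right.2 (.refl _ (Sum.inr a))⟩
  · intro s hs t ht h
    obtain ⟨a, rfl⟩ : ∃ a, Sum.inl a = s := by simpa [Finset.mem_disjSum] using hs
    have : t ∈ ({Sum.inl a, Sum.inr a} : Set (α ⊕ α)) :=
      h.mem_of_mapsTo (by rintro x (rfl | rfl) <;> simp) (by simp)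
    rcases this with rfl | rfl
    · rfl
    · simp at ht

namespace Compass

variable (c : G.Compass)

/-- `P` is the edge set of directed cycles that cut the surface, and `X` is the set of edges of the
part to the left of the cut.  This is expressed vertex by vertex: all edges at `v` are in `X`, or
none is in `X` or `P`, or `P` uses the two right edges at `v` and the other two edges are in `X`, or
`P` uses the two left edges at `v` and the other two edges are not in `X`.  That `P` is a single
cycle is not part of the definition; it enters through the sign of `IsPredecessor` permutations. -/
def IsCut (X P : Finset E) : Prop :=
  Disjoint X P ∧ ∀ v,
    (c.lo v ∈ X ∧ c.ro v ∈ X ∧ c.ri v ∈ X ∧ c.li v ∈ X) ∨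
    ((c.lo v ∉ X ∧ c.lo v ∉ P) ∧ (c.ro v ∉ X ∧ c.ro v ∉ P) ∧
      (c.ri v ∉ X ∧ c.ri v ∉ P) ∧ (c.li v ∉ X ∧ c.li v ∉ P)) ∨
    (c.lo v ∈ X ∧ c.ro v ∈ P ∧ c.ri v ∈ P ∧ c.li v ∈ X) ∨
    (c.lo v ∈ P ∧ (c.ro v ∉ X ∧ c.ro v ∉ P) ∧ (c.ri v ∉ X ∧ c.ri v ∉ P) ∧ c.li v ∈ P)

variable {c} {X P : Finset E}

theorem lo_injective : Function.Injective c.lo := fun v w h => by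
  rw [← c.tail_lo v, h, c.tail_lo]

variable [DecidableEq E]

/-- The traversals whose left side lies in the part of the surface to the left of the cut. -/
def leftSide (X P : Finset E) : Finset (E ⊕ E) := (X ∪ P).disjSum X

@[simp] theorem inl_mem_leftSide {e : E} : Sum.inl e ∈ leftSide X P ↔ e ∈ X ∨ e ∈ P := by
  simp [leftSide]

@[simp] theorem inr_mem_leftSide {e : E} : Sum.inr e ∈ leftSide X P ↔ e ∈ X := by
  simp [leftSide]

/-- The part to the left of the cut is a union of complete faces. -/
theorem IsCut.faceNext_mem_leftSide_iff (h : c.IsCut X P) (d : E ⊕ E) :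
    G.faceNext d ∈ leftSide X P ↔ d ∈ leftSide X P := by
  have hd : ∀ e ∈ X, e ∉ P := fun e he => Finset.disjoint_left.1 h.1 he
  rcases d with e | e
  · rw [faceNext_inl]
    rcases c.eq_ri_or_eq_li e with he | he <;> rw [he]
    · rw [c.rot_ri, inl_mem_leftSide, inr_mem_leftSide]
      rcases h.2 (G.head e) with hk | hk | hk | hk <;> simp [hk]
      exact fun h' => hd _ h' hk.2.2.2
    · rw [c.rot_li, inl_mem_leftSide, inl_mem_leftSide]
      rcases h.2 (G.head e) with hk | hk | hk | hk <;> simp [hk]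
  · rw [faceNext_inr]
    rcases c.eq_lo_or_eq_ro e with he | he <;> rw [he]
    · rw [c.rot_lo, inl_mem_leftSide, inr_mem_leftSide]
      rcases h.2 (G.tail e) with hk | hk | hk | hk <;> simp [hk]
      exact fun h' => hd _ h' hk.1
    · rw [c.rot_ro, inr_mem_leftSide, inr_mem_leftSide]
      rcases h.2 (G.tail e) with hk | hk | hk | hk
      · simp [hk]
      · simp [hk]
      · exact iff_of_false (fun h' => hd _ h' hk.2.2.1) (fun h' => hd _ h' hk.2.1)
      · simp [hk]

/-- The permutation that traces the faces to the left of the cut and fixes all other traversals. -/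
def IsCut.leftFaces (h : c.IsCut X P) : Equiv.Perm (E ⊕ E) :=
  Equiv.Perm.ofSubtype (G.faceNext.subtypePerm h.faceNext_mem_leftSide_iff)

theorem IsCut.leftFaces_of_mem (h : c.IsCut X P) {d : E ⊕ E} (hd : d ∈ leftSide X P) :
    h.leftFaces d = G.faceNext d := by
  rw [leftFaces, Equiv.Perm.ofSubtype_apply_of_mem _ hd]; rfl

theorem IsCut.leftFaces_of_notMem (h : c.IsCut X P) {d : E ⊕ E} (hd : d ∉ leftSide X P) :
    h.leftFaces d = d :=
  Equiv.Perm.ofSubtype_apply_of_not_mem _ hd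

/-- `ρ` sends every edge in `P` to an edge of `P` that can precede it in a directed walk, and fixes
all other edges. -/
def IsPredecessor (G : EmbeddedDigraph V E) (P : Finset E) (ρ : Equiv.Perm E) : Prop :=
  (∀ e ∉ P, ρ e = e) ∧ ∀ e ∈ P, ρ e ∈ P ∧ G.head (ρ e) = G.tail e

/-- The rotation of the surface that consists of the faces to the left of the cut and of one further
face, which is glued in along the cycle; `ρ` traces that face.  An edge in neither `X` nor `P` is a
component of its own: its two ends are interchanged. -/
def IsCut.cappedRot (h : c.IsCut X P) (ρ : Equiv.Perm E) : Equiv.Perm (E ⊕ E) :=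
  h.leftFaces * Equiv.Perm.sumCongr 1 ρ * Equiv.sumComm E E

variable {ρ : Equiv.Perm E}

theorem IsCut.cappedRot_inr (h : c.IsCut X P) {e : E} (he : e ∈ X ∪ P) :
    h.cappedRot ρ (Sum.inr e) = G.rot (Sum.inr e) :=
  h.leftFaces_of_mem (d := Sum.inl e) (by simpa using he)

theorem IsCut.cappedRot_inr_of_notMem (h : c.IsCut X P) {e : E} (he : e ∉ X ∪ P) :
    h.cappedRot ρ (Sum.inr e) = Sum.inl e :=
  h.leftFaces_of_notMem (d := Sum.inl e) (by simpa using he)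

theorem IsCut.cappedRot_inl (h : c.IsCut X P) (hρ : IsPredecessor G P ρ) {e : E} (he : e ∈ X) :
    h.cappedRot ρ (Sum.inl e) = G.rot (Sum.inl e) := by
  have h1 : ρ e = e := hρ.1 e (Finset.disjoint_left.1 h.1 he)
  have h2 : h.leftFaces (Sum.inr e) = G.rot (Sum.inl e) :=
    h.leftFaces_of_mem (d := Sum.inr e) (by simpa using he)
  simp [cappedRot, h1, h2]

theorem IsCut.cappedRot_inl_of_notMem (h : c.IsCut X P) (hρ : IsPredecessor G P ρ) {e : E}
    (he : e ∉ X) : h.cappedRot ρ (Sum.inl e) = Sum.inr (ρ e) := by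
  have h0 : ρ e ∉ X := by
    by_cases heP : e ∈ P
    · exact Finset.disjoint_right.1 h.1 (hρ.2 e heP).1
    · rwa [hρ.1 e heP]
  have h2 : h.leftFaces (Sum.inr (ρ e)) = Sum.inr (ρ e) :=
    h.leftFaces_of_notMem (by simpa using h0)
  simp [cappedRot, h2]

/-- The vertices of the capped surface: the ends of an edge in `X` or `P` keep their vertices. -/
def cappedVertex (G : EmbeddedDigraph V E) (X P : Finset E) (d : E ⊕ E) : V ⊕ E :=
  if Sum.elim id id d ∈ X ∪ P then Sum.inl (G.src d) else Sum.inr (Sum.elim id id d)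

theorem IsCut.cappedVertex_cappedRot (h : c.IsCut X P) (hρ : IsPredecessor G P ρ) (d : E ⊕ E) :
    cappedVertex G X P (h.cappedRot ρ d) = cappedVertex G X P d := by
  have key : ∀ x y : E ⊕ E, Sum.elim id id x ∈ X ∪ P → Sum.elim id id y ∈ X ∪ P →
      G.src y = G.src x → cappedVertex G X P y = cappedVertex G X P x := fun x y hx hy hxy => by
    simp [cappedVertex, hx, hy, hxy]
  have hd : ∀ e ∈ X, e ∉ P := fun e he => Finset.disjoint_left.1 h.1 he
  rcases d with e | e
  · by_cases heX : e ∈ X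
    · rw [h.cappedRot_inl hρ heX]
      refine key _ _ (by simp [heX]) ?_ (G.src_rot _)
      obtain ⟨v, rfl | rfl⟩ : ∃ v, e = c.lo v ∨ e = c.ro v := ⟨_, c.eq_lo_or_eq_ro e⟩
      · rw [c.rot_lo]
        rcases h.2 v with hk | hk | hk | hk <;> simp_all
      · rw [c.rot_ro]
        rcases h.2 v with hk | hk | hk | hk <;> simp_all
    · rw [h.cappedRot_inl_of_notMem hρ heX]
      by_cases heP : e ∈ P
      · exact key _ _ (by simp [heP]) (by simp [(hρ.2 e heP).1]) (hρ.2 e heP).2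
      · rw [hρ.1 e heP]
        simp [cappedVertex, heX, heP]
  · by_cases he' : e ∈ X ∪ P
    · rw [h.cappedRot_inr he']
      refine key _ _ (by simpa using he') ?_ (G.src_rot _)
      obtain ⟨v, rfl | rfl⟩ : ∃ v, e = c.ri v ∨ e = c.li v := ⟨_, c.eq_ri_or_eq_li e⟩
      · rw [c.rot_ri]
        rcases h.2 v with hk | hk | hk | hk <;> simp_all
      · rw [c.rot_li]
        rcases h.2 v with hk | hk | hk | hk <;> simp_all
    · rw [h.cappedRot_inr_of_notMem he']
      exact (if_neg he').trans (if_neg he').symm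

/-- The edge ends at a vertex of the capped surface form one cycle of its rotation, and the left
outgoing edge is among them. -/
theorem IsCut.sameCycle_cappedRot (h : c.IsCut X P) (hρ : IsPredecessor G P ρ) {d : E ⊕ E}
    (hd : Sum.elim id id d ∈ X ∪ P) :
    c.lo (G.src d) ∈ X ∪ P ∧ (h.cappedRot ρ).SameCycle d (Sum.inl (c.lo (G.src d))) := by
  have step : ∀ x y z, h.cappedRot ρ x = y → (h.cappedRot ρ).SameCycle y z →
      (h.cappedRot ρ).SameCycle x z := fun x y z hxy hyz => by
    rwa [← hxy, Equiv.Perm.sameCycle_apply_left] at hyz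
  have hdisj : ∀ e ∈ X, e ∉ P := fun e he => Finset.disjoint_left.1 h.1 he
  have hdisj' : ∀ e ∈ P, e ∉ X := fun e he => Finset.disjoint_right.1 h.1 he
  obtain ⟨v, hv⟩ : ∃ v, G.src d = v := ⟨_, rfl⟩
  rw [hv]
  have hli : c.li v ∈ X ∪ P → (h.cappedRot ρ).SameCycle (Sum.inr (c.li v)) (Sum.inl (c.lo v)) :=
    fun h' => step _ _ _ ((h.cappedRot_inr h').trans (c.rot_li v)) (.refl _ _)
  have hri : c.ri v ∈ X ∪ P → c.li v ∈ X ∪ P →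
      (h.cappedRot ρ).SameCycle (Sum.inr (c.ri v)) (Sum.inl (c.lo v)) :=
    fun h' h'' => step _ _ _ ((h.cappedRot_inr h').trans (c.rot_ri v)) (hli h'')
  have hcase : d = Sum.inl (c.lo v) ∨ d = Sum.inl (c.ro v) ∨ d = Sum.inr (c.ri v) ∨
      d = Sum.inr (c.li v) := by
    rcases d with e | e
    · rcases (c.tail_eq_iff v e).1 hv with rfl | rfl <;> simp
    · rcases (c.head_eq_iff v e).1 hv with rfl | rfl <;> simp
  rcases h.2 v with ⟨hk1, hk2, hk3, hk4⟩ | hk | ⟨hk1, hk2, hk3, hk4⟩ | ⟨hk1, hk2, hk3, hk4⟩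
  · refine ⟨by simp [hk1], ?_⟩
    rcases hcase with rfl | rfl | rfl | rfl
    · exact .refl _ _
    · exact step _ _ _ ((h.cappedRot_inl hρ hk2).trans (c.rot_ro v))
        (hri (by simp [hk3]) (by simp [hk4]))
    · exact hri (by simp [hk3]) (by simp [hk4])
    · exact hli (by simp [hk4])
  · rcases hcase with rfl | rfl | rfl | rfl <;> simp [hk] at hd
  · refine ⟨by simp [hk1], ?_⟩
    rcases hcase with rfl | rfl | rfl | rfl
    · exact .refl _ _
    · have hρv : ρ (c.ro v) = c.ri v := by
        obtain ⟨h1, h2⟩ := hρ.2 _ hk2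
        rw [c.tail_ro, c.head_eq_iff] at h2
        exact h2.resolve_right fun h3 => hdisj _ hk4 (h3 ▸ h1)
      exact step _ _ _ ((h.cappedRot_inl_of_notMem hρ (hdisj' _ hk2)).trans (by rw [hρv]))
        (hri (by simp [hk3]) (by simp [hk4]))
    · exact hri (by simp [hk3]) (by simp [hk4])
    · exact hli (by simp [hk4])
  · refine ⟨by simp [hk1], ?_⟩
    rcases hcase with rfl | rfl | rfl | rfl
    · exact .refl _ _
    · simp [hk2] at hd
    · simp [hk3] at hd
    · exact hli (by simp [hk4])

variable [Fintype V]

theorem card_image_lo (S : Finset E) : ((Finset.univ.filter fun v => c.lo v ∈ S).image c.lo).card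
    = (Finset.univ.filter fun v => c.lo v ∈ S).card :=
  Finset.card_image_of_injective _ lo_injective

variable [Fintype E]

/-- The faces to the left of the cut correspond to their source corners, i.e. to the vertices whose
left outgoing edge is in `X`; all other traversals are fixed points. -/
theorem IsCut.sign_leftFaces (h : c.IsCut X P) : Equiv.Perm.sign h.leftFaces =
    (-1) ^ ((X ∪ P)ᶜ.card + (Xᶜ.card + (Finset.univ.filter fun v => c.lo v ∈ X).card)) := by
  have hdisj : Disjoint Xᶜ ((Finset.univ.filter fun v => c.lo v ∈ X).image c.lo) := by
    rw [Finset.disjoint_left]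
    intro e he he'
    obtain ⟨v, hv, rfl⟩ := Finset.mem_image.1 he'
    simp_all
  rw [Equiv.Perm.sign_eq_neg_one_pow_of_transversal _ ((X ∪ P)ᶜ.disjSum
      (Xᶜ ∪ (Finset.univ.filter fun v => c.lo v ∈ X).image c.lo)), Finset.card_disjSum,
    Finset.card_union_of_disjoint hdisj, card_image_lo, Fintype.card_sum, pow_add _ (_ + _)]
  · simp [← two_mul]
  · intro d
    by_cases hd : d ∈ leftSide X P
    · obtain ⟨v, hv⟩ := c.exists_sameCycle d
      have hK : Sum.inr (c.lo v) ∈ {x | x ∈ leftSide X P ∧ h.leftFaces.SameCycle d x} := by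
        refine hv.mem_of_mapsTo ?_ ⟨hd, .refl _ _⟩
        intro x hx
        refine ⟨(h.faceNext_mem_leftSide_iff x).2 hx.1, ?_⟩
        rw [← h.leftFaces_of_mem hx.1, Equiv.Perm.sameCycle_apply_right]
        exact hx.2
      refine ⟨_, ?_, hK.2⟩
      have : c.lo v ∈ X := inr_mem_leftSide.1 hK.1
      exact Finset.inr_mem_disjSum.2 (Finset.mem_union_right _
        (Finset.mem_image_of_mem _ (by simpa using this)))
    · refine ⟨d, ?_, .refl _ _⟩
      rcases d with e | e <;> simp_all
  · intro s hs t ht hst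
    by_cases hs' : s ∈ leftSide X P
    · by_cases ht' : t ∈ leftSide X P
      · have hK : t ∈ {x | x ∈ leftSide X P ∧ G.faceNext.SameCycle s x} := by
          refine hst.mem_of_mapsTo ?_ ⟨hs', .refl _ _⟩
          intro x hx
          rw [h.leftFaces_of_mem hx.1]
          exact ⟨(h.faceNext_mem_leftSide_iff x).2 hx.1, Equiv.Perm.sameCycle_apply_right.2 hx.2⟩
        have hlo : ∀ s ∈ leftSide X P, s ∈ (X ∪ P)ᶜ.disjSum
            (Xᶜ ∪ (Finset.univ.filter fun v => c.lo v ∈ X).image c.lo) →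
            ∃ v, s = Sum.inr (c.lo v) := by
          rintro (e | e) h1 h2
          · simp_all
          · have : e ∈ X := by simpa using h1
            simp only [Finset.inr_mem_disjSum, Finset.mem_union, Finset.mem_compl, this,
              not_true_eq_false, false_or, Finset.mem_image] at h2
            obtain ⟨v, -, rfl⟩ := h2
            exact ⟨v, rfl⟩
        obtain ⟨v, rfl⟩ := hlo s hs' hs
        obtain ⟨w, rfl⟩ := hlo t ht' ht
        rw [c.eq_of_sameCycle v w hK.2]
      · exact hst.eq_of_right (h.leftFaces_of_notMem ht')
    · exact hst.eq_of_left (h.leftFaces_of_notMem hs')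

/-- The orbits are the vertices that are incident with `X` or `P`, each represented by its left
outgoing edge, and the edges that are in neither of these sets. -/
theorem IsCut.sign_cappedRot (h : c.IsCut X P) (hρ : IsPredecessor G P ρ) :
    Equiv.Perm.sign (h.cappedRot ρ) =
      (-1) ^ ((X ∪ P)ᶜ.card + (Finset.univ.filter fun v => c.lo v ∈ X ∪ P).card) := by
  have hdisj : Disjoint (X ∪ P)ᶜ ((Finset.univ.filter fun v => c.lo v ∈ X ∪ P).image c.lo) := by
    rw [Finset.disjoint_left]
    intro e he he'
    obtain ⟨v, hv, rfl⟩ := Finset.mem_image.1 he'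
    simp_all
  have hmem : ∀ e, e ∉ X ∪ P ∨ (∃ v, c.lo v ∈ X ∪ P ∧ c.lo v = e) ↔
      Sum.inl e ∈ ((X ∪ P)ᶜ ∪ (Finset.univ.filter fun v => c.lo v ∈ X ∪ P).image c.lo).disjSum
        (∅ : Finset E) := fun e => by
    rw [Finset.inl_mem_disjSum, Finset.mem_union (s := (X ∪ P)ᶜ), Finset.mem_compl,
      Finset.mem_image]
    simp only [Finset.mem_filter, Finset.mem_univ, true_and]
  rw [Equiv.Perm.sign_eq_neg_one_pow_of_transversal _
      (((X ∪ P)ᶜ ∪ (Finset.univ.filter fun v => c.lo v ∈ X ∪ P).image c.lo).disjSum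
        (∅ : Finset E)), Finset.card_disjSum,
    Finset.card_union_of_disjoint hdisj, card_image_lo, Fintype.card_sum, pow_add _ (_ + _)]
  · simp [← two_mul]
  · intro d
    by_cases hd : Sum.elim id id d ∈ X ∪ P
    · obtain ⟨h1, h2⟩ := h.sameCycle_cappedRot hρ hd
      exact ⟨_, (hmem _).1 (Or.inr ⟨_, h1, rfl⟩), h2⟩
    · rcases d with e | e
      · exact ⟨_, (hmem e).1 (Or.inl hd), .refl _ _⟩
      · refine ⟨_, (hmem e).1 (Or.inl hd), ?_⟩
        have := h.cappedRot_inr_of_notMem (ρ := ρ) hd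
        simp only [Sum.elim_inr, id] at this
        rw [← this, Equiv.Perm.sameCycle_apply_right]
  · intro s hs t ht hst
    have hvert : cappedVertex G X P t = cappedVertex G X P s :=
      hst.mem_of_mapsTo (K := {x | cappedVertex G X P x = cappedVertex G X P s})
        (fun x hx => (h.cappedVertex_cappedRot hρ x).trans hx) rfl
    have hform : ∀ s ∈ ((X ∪ P)ᶜ ∪
        (Finset.univ.filter fun v => c.lo v ∈ X ∪ P).image c.lo).disjSum (∅ : Finset E),
        (∃ e, s = Sum.inl e ∧ cappedVertex G X P s = Sum.inr e) ∨
        (∃ v, s = Sum.inl (c.lo v) ∧ cappedVertex G X P s = Sum.inl v) := by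
      rintro (e | e) hs
      · rcases (hmem e).2 hs with h1 | ⟨v, h1, rfl⟩
        · exact Or.inl ⟨e, rfl, if_neg h1⟩
        · exact Or.inr ⟨v, rfl, (if_pos h1).trans (by simp)⟩
      · simp at hs
    rcases hform s hs with ⟨e, rfl, h1⟩ | ⟨v, rfl, h1⟩ <;>
      rcases hform t ht with ⟨e', rfl, h2⟩ | ⟨v', rfl, h2⟩ <;>
      rw [h1, h2] at hvert <;> simp_all

/-- The capped surface would have an odd Euler characteristic; its faces to the left of the cut are
counted by their source corners. -/
theorem IsCut.false (h : c.IsCut X P) (hρ : IsPredecessor G P ρ)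
    (hsign : Equiv.Perm.sign ρ = (-1) ^ (P.card + 1)) : False := by
  -- At every vertex, the left outgoing edge is in `X` if and only if the right outgoing edge is in
  -- `X` or `P`.
  have hlo : (Finset.univ.filter fun v => c.lo v ∈ X).card =
      (Finset.univ.filter fun v => c.ro v ∈ X ∪ P).card := by
    have hd : ∀ e ∈ P, e ∉ X := fun e he => Finset.disjoint_right.1 h.1 he
    congr 1
    ext v
    simp only [Finset.mem_filter, Finset.mem_univ, true_and, Finset.mem_union]
    rcases h.2 v with hk | hk | hk | hk
    · simp [hk]
    · simp [hk]
    · simp [hk]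
    · exact iff_of_false (hd _ hk.1) (by simp [hk])
  have hmul : Equiv.Perm.sign (h.cappedRot ρ) = Equiv.Perm.sign h.leftFaces *
      Equiv.Perm.sign ρ * Equiv.Perm.sign (Equiv.sumComm E E : Equiv.Perm (E ⊕ E)) := by
    rw [cappedRot, Equiv.Perm.sign_mul, Equiv.Perm.sign_mul, Equiv.Perm.sign_sumCongr]
    simp
  rw [h.sign_cappedRot hρ, h.sign_leftFaces, hsign, sign_sumComm, ← pow_add, ← pow_add] at hmul
  have hcount : ∀ S : Finset E, (Finset.univ.filter fun v => c.lo v ∈ S).card +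
      (Finset.univ.filter fun v => c.ro v ∈ S).card = S.card := fun S => by
    rw [Finset.card_filter, Finset.card_filter, ← Finset.sum_add_distrib,
      c.sum_lo_add_ro fun e => if e ∈ S then 1 else 0, ← Finset.card_filter,
      Finset.filter_univ_mem]
  have hX := hcount X
  have hXP := hcount (X ∪ P)
  -- The number of edges is even, since two edges leave each vertex.
  have hE := hcount Finset.univ
  have hunion : (X ∪ P).card = X.card + P.card := Finset.card_union_of_disjoint h.1
  have h1 : (X ∪ P).card + (X ∪ P)ᶜ.card = Fintype.card E := Finset.card_add_card_compl _
  have h2 : X.card + Xᶜ.card = Fintype.card E := Finset.card_add_card_compl _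
  simp only [Finset.mem_univ, Finset.filter_true, Finset.card_univ] at hE
  have hone := congrArg (· * (-1 : ℤˣ) ^ ((X ∪ P)ᶜ.card +
    (Finset.univ.filter fun v => c.lo v ∈ X ∪ P).card)) hmul
  simp only [← pow_add] at hone
  rw [Even.neg_one_pow ⟨_, rfl⟩, Odd.neg_one_pow] at hone
  · exact absurd hone (by decide)
  · rw [Nat.odd_iff]
    omega

end Compass

/-! ### Passages of circuits and walks -/

theorem mk_formPerm_mem_circuitPassages [DecidableEq E] {C : List E} (hC : C.Nodup) {e : E}
    (he : e ∈ C) : (e, C.formPerm e) ∈ circuitPassages C := by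
  obtain ⟨i, hi, rfl⟩ := List.mem_iff_getElem.1 he
  rw [List.formPerm_apply_getElem _ hC]
  exact mem_circuitPassages_iff.2 ⟨i, hi, rfl⟩

theorem IsDirectedCircuit.head_eq_tail_formPerm [DecidableEq E] {C : List E}
    (hC : G.IsDirectedCircuit C) {e : E} (he : e ∈ C) : G.head e = G.tail (C.formPerm e) :=
  hC.2.2 _ (mk_formPerm_mem_circuitPassages hC.2.1 he)

theorem IsDirectedCircuit.head_mem_circuitVertices [DecidableEq E] {C : List E}
    (hC : G.IsDirectedCircuit C) {e : E} (he : e ∈ C) : G.head e ∈ G.circuitVertices C :=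
  ⟨_, List.formPerm_apply_mem_of_mem he, (hC.head_eq_tail_formPerm he).symm⟩

theorem IsDirectedCycle.eq_of_tail_eq {C : List E} (hC : G.IsDirectedCycle C) {e e' : E}
    (he : e ∈ C) (he' : e' ∈ C) (h : G.tail e = G.tail e') : e = e' :=
  List.inj_on_of_nodup_map hC.2 he he' h

theorem IsDirectedCycle.eq_of_head_eq {C : List E} (hC : G.IsDirectedCycle C) {e e' : E}
    (he : e ∈ C) (he' : e' ∈ C) (h : G.head e = G.head e') : e = e' := by
  classical
  rw [hC.1.head_eq_tail_formPerm he, hC.1.head_eq_tail_formPerm he'] at h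
  exact C.formPerm.injective (hC.eq_of_tail_eq (List.formPerm_apply_mem_of_mem he)
    (List.formPerm_apply_mem_of_mem he') h)

theorem isPredecessor_formPerm_inv [DecidableEq E] {P : List E} (hP : G.IsDirectedCircuit P) :
    Compass.IsPredecessor G P.toFinset P.formPerm⁻¹ := by
  refine ⟨fun e he => ?_, fun e he => ?_⟩
  · rw [Equiv.Perm.inv_eq_iff_eq, List.formPerm_apply_of_notMem (by simpa using he)]
  · have h1 : P.formPerm⁻¹ e ∈ P := by
      rw [← List.formPerm_mem_iff_mem]; simpa using he
    exact ⟨by simpa using h1, by rw [hP.head_eq_tail_formPerm h1]; simp⟩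

namespace Compass

variable (c : G.Compass)

/-- A cycle in an osculating partition does not enter a vertex on one side and leave it on the other,
since the second passage of the partition at that vertex would be transverse to it. -/
theorem cases_of_mem_circuitVertices {Part : Set (List E)} (hPart : G.IsOsculatingPartition Part)
    {P : List E} (hP : P ∈ Part) (hcycle : G.IsDirectedCycle P) {v : V}
    (hv : v ∈ G.circuitVertices P) :
    (c.lo v ∉ P ∧ c.ro v ∈ P ∧ c.ri v ∈ P ∧ c.li v ∉ P) ∨
      (c.lo v ∈ P ∧ c.ro v ∉ P ∧ c.ri v ∉ P ∧ c.li v ∈ P) := by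
  classical
  obtain ⟨hcirc, huniq, hosc⟩ := hPart
  have hout : c.lo v ∈ P → c.ro v ∉ P := fun h h' =>
    c.lo_ne_ro v (hcycle.eq_of_tail_eq h h' (by simp))
  have hin : c.ri v ∈ P → c.li v ∉ P := fun h h' =>
    c.ri_ne_li v (hcycle.eq_of_head_eq h h' (by simp))
  obtain ⟨e, he, hev⟩ := hv
  -- The edge of `P` before `e`.
  obtain ⟨e', he', he'v, hpass⟩ : ∃ e' ∈ P, G.head e' = v ∧ (e', e) ∈ circuitPassages P := by
    obtain ⟨h1, h2⟩ := (isPredecessor_formPerm_inv hcycle.1).2 e (by simpa using he)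
    refine ⟨_, by simpa using h1, h2.trans hev, ?_⟩
    simpa using mk_formPerm_mem_circuitPassages hcycle.1.2.1 (List.mem_toFinset.1 h1)
  -- The circuit through an edge that enters `v` and is not in `P` leaves `v` along an edge not in
  -- `P`.
  have hother : ∀ f ∉ P, G.head f = v → ∃ D ∈ Part, ∃ g ∉ P, G.tail g = v ∧
      (f, g) ∈ circuitPassages D := by
    intro f hf hfv
    obtain ⟨D, ⟨hD, hfD⟩, -⟩ := huniq f
    refine ⟨D, hD, _, fun hg => ?_, ?_, mk_formPerm_mem_circuitPassages (hcirc D hD).2.1 hfD⟩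
    · have := (huniq _).unique ⟨hP, hg⟩ ⟨hD, List.formPerm_apply_mem_of_mem hfD⟩
      exact hf (this ▸ hfD)
    · rw [← (hcirc D hD).head_eq_tail_formPerm hfD, hfv]
  rcases (c.tail_eq_iff v e).1 hev with rfl | rfl <;>
    rcases (c.head_eq_iff v e').1 he'v with rfl | rfl
  · obtain ⟨D, hD, g, hg, hgv, hD'⟩ := hother (c.li v) (hin he') (by simp)
    obtain rfl : g = c.ro v := ((c.tail_eq_iff v g).1 hgv).resolve_left fun h => hg (h ▸ he)
    exact absurd ⟨_, hD', _, hpass, Or.inl ⟨by simp, c.isLeftIn_li v, c.isRightOut_ro v,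
      c.isRightIn_ri v, c.isLeftOut_lo v⟩⟩ (hosc D hD P hP)
  · exact Or.inr ⟨he, hout he, fun h => hin h he', he'⟩
  · exact Or.inl ⟨fun h => hout h he, he, he', hin he'⟩
  · obtain ⟨D, hD, g, hg, hgv, hD'⟩ := hother (c.ri v) (fun h => hin h he') (by simp)
    obtain rfl : g = c.lo v := ((c.tail_eq_iff v g).1 hgv).resolve_right fun h => hg (h ▸ he)
    exact absurd ⟨_, hD', _, hpass, Or.inr ⟨by simp, c.isLeftIn_li v, c.isRightOut_ro v,
      c.isRightIn_ri v, c.isLeftOut_lo v⟩⟩ (hosc D hD P hP)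

end Compass

/-! ### Walks that leave a cycle to the left -/

/-- `e'` can follow `e` in a walk that avoids the edges and the vertices of `P`. -/
def AvoidingStep (G : EmbeddedDigraph V E) (P : List E) (e e' : E) : Prop :=
  G.head e = G.tail e' ∧ e' ∉ P ∧ G.head e ∉ G.circuitVertices P

/-- `e` is the last edge of a walk that leaves `P` to the left and does not meet `P` again before
its end. -/
def ReachedFromLeft (G : EmbeddedDigraph V E) (P : List E) (e : E) : Prop :=
  ∃ e₀, G.tail e₀ ∈ G.circuitVertices P ∧ G.IsLeftOut e₀ ∧ e₀ ∉ P ∧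
    Relation.ReflTransGen (G.AvoidingStep P) e₀ e

theorem ReachedFromLeft.notMem {P : List E} {e : E} (h : G.ReachedFromLeft P e) : e ∉ P := by
  obtain ⟨e₀, -, -, h0, h⟩ := h
  rcases Relation.ReflTransGen.cases_tail h with rfl | ⟨b, -, hb⟩
  exacts [h0, hb.2.1]

theorem rel_of_mem_walkPassages {R : E → E → Prop} {l : List E} (hl : l.IsChain R) {p : E × E}
    (hp : p ∈ walkPassages l) : R p.1 p.2 := by
  obtain ⟨i, hi, rfl⟩ := List.mem_iff_getElem.1 hp
  have hi' : i + 1 < l.length := by simp [walkPassages] at hi; omega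
  simpa [walkPassages] using List.isChain_iff_getElem.1 hl i hi'

theorem ReachedFromLeft.exists_walk {P : List E} (hP : G.IsDirectedCircuit P) {e : E}
    (h : G.ReachedFromLeft P e) : ∃ (W : List E) (hW : W ≠ []),
      G.IsDirectedWalk W ∧
      (G.tail (W.head hW) ∈ G.circuitVertices P ∧
        G.IsLeftOut (W.head hW) ∧ W.head hW ∉ P) ∧
      W.getLast hW = e ∧
      ¬ G.HasTransverseIntersection (walkPassages W) (circuitPassages P) ∧
      List.Disjoint W P := by
  classical
  obtain ⟨e₀, h1, h2, h3, h⟩ := h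
  obtain ⟨l, hl, hlast⟩ := List.exists_isChain_cons_of_relationReflTransGen h
  refine ⟨e₀ :: l, by simp, ⟨by simp, fun p hp => (rel_of_mem_walkPassages hl hp).1⟩,
    ⟨h1, h2, h3⟩, hlast, ?_, ?_⟩
  · rintro ⟨p, hp, q, hq, hcross⟩
    have hhead : G.head p.1 = G.head q.1 := by
      rcases hcross with h | h
      exacts [h.1, h.1.symm]
    refine (rel_of_mem_walkPassages hl hp).2.2 ?_
    rw [hhead]
    exact hP.head_mem_circuitVertices (List.of_mem_zip hq).1
  · intro f hf
    obtain ⟨i, hi, rfl⟩ := List.mem_iff_getElem.1 hf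
    cases i with
    | zero => exact h3
    | succ i => exact (List.isChain_iff_getElem.1 hl i hi).2.1

theorem ReachedFromLeft.step {P : List E} {e e' : E} (h : G.ReachedFromLeft P e)
    (h' : G.AvoidingStep P e e') : G.ReachedFromLeft P e' := by
  obtain ⟨e₀, h1, h2, h3, h⟩ := h
  exact ⟨e₀, h1, h2, h3, h.tail h'⟩

/-- If no walk that leaves `P` to the left arrives at `P` from the right, then the edges reached by
such walks form one side of a cut of the surface along `P`.  These edges are closed under taking
successors, so that at every vertex at most as many of them come in as go out; summing over all
vertices gives equality everywhere, hence closure under taking predecessors. -/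
theorem Compass.isCut_of_forall_not_isRightIn [Fintype V] [Fintype E] [DecidableEq E]
    (c : G.Compass) {Part : Set (List E)}
    (hPart : G.IsOsculatingPartition Part) {P : List E} (hP : P ∈ Part)
    (hcycle : G.IsDirectedCycle P) [DecidablePred (G.ReachedFromLeft P)]
    (hright : ∀ e, G.ReachedFromLeft P e → G.head e ∈ G.circuitVertices P → ¬ G.IsRightIn e) :
    c.IsCut (Finset.univ.filter (G.ReachedFromLeft P)) P.toFinset := by
  have hoff : ∀ v ∉ G.circuitVertices P,
      c.lo v ∉ P ∧ c.ro v ∉ P ∧ c.ri v ∉ P ∧ c.li v ∉ P := fun v hv => by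
    refine ⟨fun h => hv ⟨_, h, by simp⟩, fun h => hv ⟨_, h, by simp⟩, fun h => hv ?_,
      fun h => hv ?_⟩
    · simpa using hcycle.1.head_mem_circuitVertices h
    · simpa using hcycle.1.head_mem_circuitVertices h
  have hout : ∀ v ∉ G.circuitVertices P, ∀ e, G.head e = v → G.ReachedFromLeft P e →
      G.ReachedFromLeft P (c.lo v) ∧ G.ReachedFromLeft P (c.ro v) := by
    rintro v hv e rfl he
    exact ⟨he.step ⟨by simp, (hoff _ hv).1, hv⟩, he.step ⟨by simp, (hoff _ hv).2.1, hv⟩⟩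
  have hlo : ∀ v ∈ G.circuitVertices P, c.lo v ∉ P → G.ReachedFromLeft P (c.lo v) :=
    fun v hv h => ⟨_, by simpa using hv, c.isLeftOut_lo v, h, .refl⟩
  have hri : ∀ v ∈ G.circuitVertices P, ¬ G.ReachedFromLeft P (c.ri v) :=
    fun v hv h => hright _ h (by simpa using hv) (c.isRightIn_ri v)
  have hnot : ∀ e ∈ P, ¬ G.ReachedFromLeft P e := fun e he h => h.notMem he
  let x : E → ℕ := fun e => if G.ReachedFromLeft P e then 1 else 0
  have hle : ∀ v ∈ Finset.univ, x (c.ri v) + x (c.li v) ≤ x (c.lo v) + x (c.ro v) := by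
    intro v _
    by_cases hv : v ∈ G.circuitVertices P
    · have h1 := hri v hv
      rcases c.cases_of_mem_circuitVertices hPart hP hcycle hv with h | h
      · have h2 := hlo v hv h.1
        simp only [x, if_neg h1, if_pos h2]
        split_ifs <;> omega
      · have h2 := hnot _ h.2.2.2
        simp only [x, if_neg h1, if_neg h2]
        omega
    · by_cases h : G.ReachedFromLeft P (c.ri v) ∨ G.ReachedFromLeft P (c.li v)
      · have h1 : G.ReachedFromLeft P (c.lo v) ∧ G.ReachedFromLeft P (c.ro v) := by
          rcases h with h | h
          exacts [hout v hv _ (by simp) h, hout v hv _ (by simp) h]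
        simp only [x, if_pos h1.1, if_pos h1.2]
        split_ifs <;> omega
      · rw [not_or] at h
        simp only [x, if_neg h.1, if_neg h.2]
        omega
  have heq := (Finset.sum_eq_sum_iff_of_le hle).1
    ((c.sum_ri_add_li x).trans (c.sum_lo_add_ro x).symm)
  refine ⟨Finset.disjoint_left.2 fun e he he' => ?_, fun v => ?_⟩
  · exact hnot e (by simpa using he') (by simpa using he)
  · simp only [Finset.mem_filter, Finset.mem_univ, true_and, List.mem_toFinset]
    have hv' := heq v (Finset.mem_univ v)
    by_cases hv : v ∈ G.circuitVertices P
    · have h1 := hri v hv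
      rcases c.cases_of_mem_circuitVertices hPart hP hcycle hv with h | h
      · have h2 := hlo v hv h.1
        have h3 := hnot _ h.2.1
        simp only [x, if_neg h1, if_pos h2, if_neg h3] at hv'
        refine Or.inr (Or.inr (Or.inl ⟨h2, h.2.1, h.2.2.1, ?_⟩))
        by_contra h4
        simp [h4] at hv'
      · have h2 := hnot _ h.2.2.2
        have h3 := hnot _ h.1
        simp only [x, if_neg h1, if_neg h2, if_neg h3] at hv'
        refine Or.inr (Or.inr (Or.inr ⟨h.1, ⟨?_, h.2.1⟩, ⟨h1, h.2.2.1⟩, h.2.2.2⟩))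
        intro h4
        simp [h4] at hv'
    · obtain ⟨h1, h2, h3, h4⟩ := hoff v hv
      by_cases h : G.ReachedFromLeft P (c.ri v) ∨ G.ReachedFromLeft P (c.li v)
      · have h5 : G.ReachedFromLeft P (c.lo v) ∧ G.ReachedFromLeft P (c.ro v) := by
          rcases h with h | h
          exacts [hout v hv _ (by simp) h, hout v hv _ (by simp) h]
        simp only [x, if_pos h5.1, if_pos h5.2] at hv'
        refine Or.inl ⟨h5.1, h5.2, ?_, ?_⟩ <;> by_contra h6 <;> rw [if_neg h6] at hv' <;>
          split_ifs at hv' <;> omega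
      · rw [not_or] at h
        simp only [x, if_neg h.1, if_neg h.2] at hv'
        refine Or.inr (Or.inl ⟨⟨?_, h1⟩, ⟨?_, h2⟩, ⟨h.1, h3⟩, ⟨h.2, h4⟩⟩) <;> intro h6 <;>
          rw [if_pos h6] at hv' <;> omega

end EmbeddedDigraph

theorem mainTheorem2 {V E : Type*} [Finite V] [Finite E] (G : EmbeddedDigraph V E)
    (hC1 : G.IsTwoTwoRegular)
    (hC2 : G.IsToroidal ∧ G.FacesAtLeastThree)
    (hC3 : G.CircuitsNonContractible)
    (Part : Set (List E)) (hPart : G.IsOsculatingPartition Part)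
    (P : List E) (hP : P ∈ Part) (hcycle : G.IsDirectedCycle P) :
    ∃ (W : List E) (hW : W ≠ []),
      G.IsDirectedWalk W ∧
      (G.tail (W.head hW) ∈ G.circuitVertices P ∧
        G.IsLeftOut (W.head hW) ∧ W.head hW ∉ P) ∧
      (G.head (W.getLast hW) ∈ G.circuitVertices P ∧
        G.IsRightIn (W.getLast hW) ∧ W.getLast hW ∉ P) ∧
      ¬ G.HasTransverseIntersection (EmbeddedDigraph.walkPassages W)
          (EmbeddedDigraph.circuitPassages P) ∧
      List.Disjoint W P := by
  classical
  have := Fintype.ofFinite V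
  have := Fintype.ofFinite E
  obtain ⟨c⟩ := EmbeddedDigraph.exists_compass hC1 hC2.1 hC3
  by_contra hW
  have hcut := c.isCut_of_forall_not_isRightIn hPart hP hcycle fun e he hhead hright => by
    obtain ⟨W, hne, hwalk, hstart, rfl, htrans, hdisj⟩ := he.exists_walk hcycle.1
    exact hW ⟨W, hne, hwalk, hstart, ⟨hhead, hright, he.notMem⟩, htrans, hdisj⟩
  refine hcut.false (EmbeddedDigraph.isPredecessor_formPerm_inv hcycle.1) ?_
  rw [Equiv.Perm.sign_inv, List.sign_formPerm P hcycle.1.1 hcycle.1.2.1,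
    List.toFinset_card_of_nodup hcycle.1.2.1]
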